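/- **Proposition 2.4.** Let $X$ be a real random variable with mean $0$, variance $1$ and density $p$. The Fisher information of a density $p$ is $$I(X)=I(p)=\int_{\{p>0\}}\frac{p'(x)^2}{p(x)}\,dx$$ if $p$ is absolutely continuous (on every compact interval), where $p'$ is the Radon–Nikodym derivative of $p$, and $I(p)=+\infty$ otherwise. Let $Z$ be a standard normal random variable, with density $\varphi(x)=\frac1{\sqrt{2\pi}}e^{-x^2/2}$, and put $I(X||Z)=I(X)-I(Z)$. If $I(X)<\infty$, then $$\|p-\varphi\|_{\mathrm{TV}}\le 4\sqrt{I(X||Z)},$$ where $\|u\|_{\mathrm{TV}}=\sup\sum_{k=1}^n|u(x_k)-u(x_{k-1})|$, the supremum running over all finite collections $x_0<x_1<\dots<x_n$ of real numbers, is the total variation of the function $u$. -/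

import Mathlib

open MeasureTheory ProbabilityTheory Set
open scoped ENNReal

noncomputable section

/-- The real random variable `X` on `(Ω, P)` has the (nonnegative, everywhere defined) density `p`
with respect to Lebesgue measure. -/
def HasRealDensity {Ω : Type*} [MeasurableSpace Ω] (P : Measure Ω) (X : Ω → ℝ) (p : ℝ → ℝ) : Prop :=
  Measurable X ∧ (∀ x, 0 ≤ p x) ∧
    P.map X = (volume : Measure ℝ).withDensity (fun x => ENNReal.ofReal (p x))

/-- Absolute continuity of a function on the real line: absolute continuity, in the usual
`ε`-`δ` sense, on every compact interval. -/
def IsAbsCont (p : ℝ → ℝ) : Prop :=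
  ∀ a b : ℝ, AbsolutelyContinuousOnInterval p a b

open Classical in
/-- The Fisher information `I(p) = ∫ p'(x)² / p(x) dx` of a density `p`, the integral being
extended over `{p > 0}`; it is `+∞` if `p` is not absolutely continuous. An absolutely continuous
`p` is differentiable almost everywhere and `deriv p` is then its Radon-Nikodym derivative. -/
def fisherInfo (p : ℝ → ℝ) : ℝ≥0∞ :=
  if IsAbsCont p then ∫⁻ x in {x | 0 < p x}, ENNReal.ofReal ((deriv p x) ^ 2 / p x) else ∞

/-- The density of the standard normal distribution `N(0, 1)`. -/
def stdNormalDensity : ℝ → ℝ := gaussianPDFReal 0 1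

/-- The relative Fisher information `I(X||Z) = I(X) - I(Z)` of a random variable `X` with density
`p` and finite Fisher information, with mean zero and variance one, with respect to a standard
normal random variable `Z`. -/
def relFisherInfo (p : ℝ → ℝ) : ℝ :=
  (fisherInfo p).toReal - (fisherInfo stdNormalDensity).toReal

/-- The total variation norm of a function `u` on the real line, in the sense of the theory of
functions: the supremum of the sums `∑ |u (x (k + 1)) - u (x k)|` over all finite increasing
collections of points. -/
def tvNorm (u : ℝ → ℝ) : ℝ≥0∞ := eVariationOn u univ

end

/- Write `u = p - φ` and `r = u' + x u`. Since `(u / φ)' = r / φ`, the function `u` is recovered from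
`u 0` and `r` by `u x = (u 0 / φ 0) φ x + φ x ∫₀ˣ r / φ`. Tonelli's theorem and two Gaussian tail
estimates bound `∫ |u - (u 0 / φ 0) φ|` by `(1 / φ 0) ∫ |r|` and `∫ |x| |u - (u 0 / φ 0) φ|` by
`∫ |r|`. The first bound and `∫ u = 0` give `|u 0| ≤ ∫ |r|`, the second then gives
`∫ |x u| ≤ 3 ∫ |r|`, and so the total variation `∫ |u'|` of `u` is at most `4 ∫ |r|`.
As `φ' + x φ = 0`, also `r = p' + x p`, and `(∫ |r|)² ≤ ∫ r² / p` by the Cauchy-Schwarz inequality.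
Expanding the square and integrating `∫ x p' = -1` by parts, one finds
`∫ r² / p = I(p) - 2 + E X²`. -/

open Filter Topology

local notation "φ" => stdNormalDensity

theorem eVariationOn_univ_le_measure_univ {α E : Type*} [LinearOrder α] [TopologicalSpace α]
    [OrderClosedTopology α] [MeasurableSpace α] [OpensMeasurableSpace α] [PseudoEMetricSpace E]
    {f : α → E} {μ : Measure α} (h : ∀ a b, a ≤ b → edist (f b) (f a) ≤ μ (Ioc a b)) :
    eVariationOn f univ ≤ μ univ := by
  refine iSup_le fun ⟨n, u, hu, _⟩ => ?_
  calc ∑ i ∈ Finset.range n, edist (f (u (i + 1))) (f (u i))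
      ≤ ∑ i ∈ Finset.range n, μ (Ioc (u i) (u (i + 1))) :=
        Finset.sum_le_sum fun i _ => h _ _ (hu (Nat.le_succ i))
    _ = μ (⋃ i ∈ Finset.range n, Ioc (u i) (u (i + 1))) :=
        (measure_biUnion_finset (fun i _ j _ hij => hu.pairwise_disjoint_on_Ioc_succ hij)
          fun i _ => measurableSet_Ioc).symm
    _ ≤ μ univ := measure_mono (subset_univ _)

namespace IsAbsCont

variable {f g : ℝ → ℝ}

theorem of_contDiff (hf : ContDiff ℝ 1 f) : IsAbsCont f :=
  fun _ _ => hf.contDiffOn.absolutelyContinuousOnInterval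

theorem sub (hf : IsAbsCont f) (hg : IsAbsCont g) : IsAbsCont fun x => f x - g x :=
  fun a b => (hf a b).fun_sub (hg a b)

theorem mul (hf : IsAbsCont f) (hg : IsAbsCont g) : IsAbsCont fun x => f x * g x :=
  fun a b => (hf a b).fun_mul (hg a b)

theorem continuous (hf : IsAbsCont f) : Continuous f := by
  refine continuous_iff_continuousAt.2 fun x => ?_
  refine (hf (x - 1) (x + 1)).continuousOn.continuousAt ?_
  rw [uIcc_of_le (by linarith)]
  exact Icc_mem_nhds (by linarith) (by linarith)

theorem ae_differentiableAt (hf : IsAbsCont f) : ∀ᵐ x, DifferentiableAt ℝ f x := by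
  have h : ∀ᵐ x, ∀ n : ℕ, x ∈ uIcc (-n : ℝ) n → DifferentiableAt ℝ f x :=
    ae_all_iff.2 fun n => (hf (-n) n).ae_differentiableAt
  filter_upwards [h] with x hx
  obtain ⟨n, hn⟩ := exists_nat_ge |x|
  refine hx n ?_
  rw [uIcc_of_le (by linarith [abs_nonneg x])]
  exact abs_le.1 hn

theorem tvNorm_le_lintegral_enorm_deriv (hf : IsAbsCont f) :
    tvNorm f ≤ ∫⁻ x, ‖deriv f x‖ₑ := by
  rw [← setLIntegral_univ, ← withDensity_apply _ MeasurableSet.univ]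
  refine eVariationOn_univ_le_measure_univ fun a b hab => ?_
  rw [edist_eq_enorm_sub, ← (hf a b).integral_deriv_eq_sub, intervalIntegral.integral_of_le hab,
    withDensity_apply _ measurableSet_Ioc]
  exact enorm_integral_le_lintegral_enorm _

theorem integral_deriv_eq_zero (hf : IsAbsCont f) (hi : Integrable f)
    (hd : Integrable (deriv f)) : ∫ x, deriv f x = 0 := by
  have hlim : Tendsto (fun x => f x - f (-x)) atTop (𝓝 (∫ x, deriv f x)) :=
    (intervalIntegral_tendsto_integral hd tendsto_neg_atTop_atBot tendsto_id).congr fun x =>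
      (hf (-x) x).integral_deriv_eq_sub
  refine ((hi.sub hi.comp_neg).integrableAtFilter atTop).eq_zero_of_tendsto (fun s hs => ?_) hlim
  obtain ⟨b, hb⟩ := mem_atTop_sets.1 hs
  exact top_unique (Real.volume_Ici (a := b) ▸ measure_mono hb)

theorem integral_id_mul_deriv (hf : IsAbsCont f) (hi : Integrable f)
    (hxi : Integrable fun x => x * f x) (hxd : Integrable fun x => x * deriv f x) :
    ∫ x, x * deriv f x = -∫ x, f x := by
  have hxf : IsAbsCont fun x => x * f x := (of_contDiff contDiff_id).mul hf
  have hd : deriv (fun x => x * f x) =ᵐ[volume] fun x => f x + x * deriv f x := by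
    filter_upwards [hf.ae_differentiableAt] with x hx
    simpa using ((hasDerivAt_id' x).fun_mul hx.hasDerivAt).deriv
  have h0 := hxf.integral_deriv_eq_zero hxi ((integrable_congr hd).2 (hi.add hxd))
  rw [integral_congr_ae hd, integral_add hi hxd] at h0
  linarith

end IsAbsCont

theorem setLIntegral_Iio_neg_of_even {F : ℝ → ℝ≥0∞} (hF : ∀ x, F (-x) = F x) (a : ℝ) :
    ∫⁻ x in Iio (-a), F x = ∫⁻ x in Ioi a, F x :=
  calc ∫⁻ x in Iio (-a), F x = ∫⁻ x in Neg.neg ⁻¹' Ioi a, F (-x) := by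
        simp only [hF, neg_preimage, neg_Ioi]
    _ = ∫⁻ x in Ioi a, F x :=
        (Measure.measurePreserving_neg volume).setLIntegral_comp_preimage_emb
          (MeasurableEquiv.neg ℝ).measurableEmbedding _ _

theorem lintegral_eq_two_mul_of_even {F : ℝ → ℝ≥0∞} (hF : ∀ x, F (-x) = F x) :
    ∫⁻ x, F x = 2 * ∫⁻ x in Ioi 0, F x := by
  have hneg : ∫⁻ x in Iio 0, F x = ∫⁻ x in Ioi 0, F x := by
    simpa using setLIntegral_Iio_neg_of_even hF 0
  rw [← lintegral_add_compl F measurableSet_Iic, compl_Iic, ← setLIntegral_congr Iio_ae_eq_Iic,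
    hneg, two_mul]

theorem setLIntegral_mem_uIoc_zero_of_even {F : ℝ → ℝ≥0∞} (hF : ∀ x, F (-x) = F x) (t : ℝ) :
    ∫⁻ x in {x | t ∈ uIoc 0 x}, F x = ∫⁻ x in Ioi |t|, F x := by
  rcases le_or_gt t 0 with ht | ht
  · have hset : {x | t ∈ uIoc 0 x} = Iio (-|t|) := by
      ext x
      simp [mem_uIoc, abs_of_nonpos ht, ht, ht.not_gt]
    rw [hset, setLIntegral_Iio_neg_of_even hF]
  · have hset : {x | t ∈ uIoc 0 x} = Ici |t| := by
      ext x
      simp [mem_uIoc, abs_of_pos ht, ht, ht.not_ge]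
    rw [hset, setLIntegral_congr Ioi_ae_eq_Ici]

theorem lintegral_setLIntegral_swap {α β : Type*} [MeasurableSpace α] [MeasurableSpace β]
    {μ : Measure α} {ν : Measure β} [SFinite μ] [SFinite ν] {s : Set (α × β)}
    (hs : MeasurableSet s) {f : α → β → ℝ≥0∞} (hf : Measurable (Function.uncurry f)) :
    ∫⁻ x, ∫⁻ y in {y | (x, y) ∈ s}, f x y ∂ν ∂μ = ∫⁻ y, ∫⁻ x in {x | (x, y) ∈ s}, f x y ∂μ ∂ν := by
  have hind : Measurable (s.indicator (Function.uncurry f)) := hf.indicator hs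
  calc ∫⁻ x, ∫⁻ y in {y | (x, y) ∈ s}, f x y ∂ν ∂μ
      = ∫⁻ x, ∫⁻ y, s.indicator (Function.uncurry f) (x, y) ∂ν ∂μ :=
        lintegral_congr fun x => (lintegral_indicator (measurable_prodMk_left hs) _).symm
    _ = ∫⁻ y, ∫⁻ x, s.indicator (Function.uncurry f) (x, y) ∂μ ∂ν :=
        lintegral_lintegral_swap hind.aemeasurable
    _ = ∫⁻ y, ∫⁻ x in {x | (x, y) ∈ s}, f x y ∂μ ∂ν :=
        lintegral_congr fun y => lintegral_indicator (measurable_prodMk_right hs) _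

theorem lintegral_lintegral_uIoc_zero_of_even {k : ℝ → ℝ → ℝ≥0∞}
    (hk : Measurable (Function.uncurry k)) (heven : ∀ x t, k (-x) t = k x t) :
    ∫⁻ x, ∫⁻ t in uIoc 0 x, k x t = ∫⁻ t, ∫⁻ x in Ioi |t|, k x t := by
  have hs : MeasurableSet {z : ℝ × ℝ | z.2 ∈ uIoc 0 z.1} :=
    (measurableSet_lt (measurable_const.min measurable_fst) measurable_snd).inter
      (measurableSet_le measurable_snd (measurable_const.max measurable_fst))
  exact (lintegral_setLIntegral_swap hs hk).trans <| lintegral_congr fun t =>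
    setLIntegral_mem_uIoc_zero_of_even (fun x => heven x t) t

section StdNormalDensity

theorem stdNormalDensity_eq (x : ℝ) : φ x = (√(2 * Real.pi))⁻¹ * Real.exp (-x ^ 2 / 2) := by
  simp [stdNormalDensity, gaussianPDFReal]

theorem stdNormalDensity_pos (x : ℝ) : 0 < φ x :=
  gaussianPDFReal_pos _ _ _ one_ne_zero

theorem stdNormalDensity_neg (x : ℝ) : φ (-x) = φ x := by
  simp only [stdNormalDensity_eq, neg_sq]

theorem contDiff_stdNormalDensity : ContDiff ℝ 1 φ := by
  rw [funext stdNormalDensity_eq]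
  fun_prop

@[fun_prop]
theorem measurable_stdNormalDensity : Measurable φ :=
  measurable_gaussianPDFReal 0 1

theorem integrable_stdNormalDensity : Integrable φ :=
  integrable_gaussianPDFReal 0 1

theorem integral_stdNormalDensity : ∫ x, φ x = 1 :=
  integral_gaussianPDFReal_eq_one 0 one_ne_zero

theorem lintegral_enorm_stdNormalDensity : ∫⁻ x, ‖φ x‖ₑ = 1 := by
  simp only [Real.enorm_of_nonneg (stdNormalDensity_pos _).le]
  exact lintegral_gaussianPDFReal_eq_one 0 one_ne_zero

theorem hasDerivAt_stdNormalDensity (x : ℝ) : HasDerivAt φ (-(x * φ x)) x := by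
  have h : HasDerivAt (fun x : ℝ => -x ^ 2 / 2) (-x) x := by
    simpa [neg_div] using ((hasDerivAt_id x).pow 2).neg.div_const 2
  rw [funext stdNormalDensity_eq]
  convert! h.exp.const_mul (√(2 * Real.pi))⁻¹ using 1
  ring

theorem tendsto_stdNormalDensity_atTop : Tendsto φ atTop (𝓝 0) := by
  have h : Tendsto (fun x : ℝ => -x ^ 2 / 2) atTop atBot :=
    (tendsto_neg_atTop_atBot.comp (tendsto_pow_atTop two_ne_zero)).atBot_div_const two_pos
  rw [funext stdNormalDensity_eq]
  simpa using (Real.tendsto_exp_atBot.comp h).const_mul (√(2 * Real.pi))⁻¹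

theorem stdNormalDensity_add_mul_le {s x : ℝ} (hsx : 0 ≤ s * x) :
    φ (s + x) * φ 0 ≤ φ s * φ x := by
  have hexp : Real.exp (-(s + x) ^ 2 / 2) ≤ Real.exp (-s ^ 2 / 2) * Real.exp (-x ^ 2 / 2) := by
    rw [← Real.exp_add, Real.exp_le_exp]
    linarith [add_sq s x]
  simp only [stdNormalDensity_eq]
  calc _ = (√(2 * Real.pi))⁻¹ ^ 2 * Real.exp (-(s + x) ^ 2 / 2) := by simp; ring
    _ ≤ (√(2 * Real.pi))⁻¹ ^ 2 * (Real.exp (-s ^ 2 / 2) * Real.exp (-x ^ 2 / 2)) := by gcongr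
    _ = _ := by ring

theorem lintegral_Ioi_enorm_stdNormalDensity_le {s : ℝ} (hs : 0 ≤ s) :
    ∫⁻ x in Ioi s, ‖φ x‖ₑ ≤ ‖(φ 0)⁻¹‖ₑ * ‖φ s‖ₑ := by
  have hle : ∀ x ∈ Ioi s, ‖φ x‖ₑ ≤ ‖(φ 0)⁻¹‖ₑ * ‖φ s‖ₑ * ‖φ (x - s)‖ₑ := fun x hx => by
    have h := stdNormalDensity_add_mul_le (mul_nonneg hs (sub_nonneg.2 (le_of_lt hx)))
    rw [add_sub_cancel, ← le_div_iff₀ (stdNormalDensity_pos 0)] at h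
    rw [← enorm_mul, ← enorm_mul, enorm_le_iff_norm_le,
      Real.norm_of_nonneg (stdNormalDensity_pos x).le]
    exact (h.trans_eq (by ring)).trans (le_abs_self _)
  calc ∫⁻ x in Ioi s, ‖φ x‖ₑ
      ≤ ∫⁻ x in Ioi s, ‖(φ 0)⁻¹‖ₑ * ‖φ s‖ₑ * ‖φ (x - s)‖ₑ :=
        setLIntegral_mono' measurableSet_Ioi hle
    _ ≤ ∫⁻ x, ‖(φ 0)⁻¹‖ₑ * ‖φ s‖ₑ * ‖φ (x - s)‖ₑ := setLIntegral_le_lintegral _ _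
    _ = ‖(φ 0)⁻¹‖ₑ * ‖φ s‖ₑ := by
        rw [lintegral_const_mul _ (by fun_prop), lintegral_sub_right_eq_self (fun x => ‖φ x‖ₑ) s,
          lintegral_enorm_stdNormalDensity, mul_one]

theorem lintegral_Ioi_enorm_mul_stdNormalDensity {s : ℝ} (hs : 0 ≤ s) :
    ∫⁻ x in Ioi s, ‖x‖ₑ * ‖φ x‖ₑ = ‖φ s‖ₑ := by
  have hderiv : ∀ x ∈ Ici s, HasDerivAt (fun x => -φ x) (x * φ x) x := fun x _ => by
    simpa using (hasDerivAt_stdNormalDensity x).fun_neg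
  have hnonneg : ∀ x ∈ Ioi s, 0 ≤ x * φ x := fun x hx =>
    mul_nonneg (hs.trans (le_of_lt hx)) (stdNormalDensity_pos x).le
  have hlim : Tendsto (fun x => -φ x) atTop (𝓝 0) := by
    simpa using tendsto_stdNormalDensity_atTop.neg
  calc ∫⁻ x in Ioi s, ‖x‖ₑ * ‖φ x‖ₑ = ∫⁻ x in Ioi s, ENNReal.ofReal (x * φ x) :=
        setLIntegral_congr_fun measurableSet_Ioi fun x hx => by
          rw [← enorm_mul, Real.enorm_of_nonneg (hnonneg x hx)]
    _ = ENNReal.ofReal (∫ x in Ioi s, x * φ x) :=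
        (ofReal_integral_eq_lintegral_ofReal (integrableOn_Ioi_deriv_of_nonneg' hderiv hnonneg hlim)
          ((ae_restrict_iff' measurableSet_Ioi).2 (ae_of_all _ hnonneg))).symm
    _ = ‖φ s‖ₑ := by
        rw [integral_Ioi_of_hasDerivAt_of_nonneg' hderiv hnonneg hlim, zero_sub, neg_neg,
          Real.enorm_of_nonneg (stdNormalDensity_pos s).le]

theorem lintegral_enorm_mul_stdNormalDensity : ∫⁻ x, ‖x‖ₑ * ‖φ x‖ₑ = 2 * ‖φ 0‖ₑ := by
  rw [lintegral_eq_two_mul_of_even fun x => by rw [enorm_neg, stdNormalDensity_neg],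
    lintegral_Ioi_enorm_mul_stdNormalDensity le_rfl]

end StdNormalDensity

/-- The residual `u' + x u` of `u` in the first-order equation `u' + x u = 0`, whose solutions are
the multiples of the standard normal density. -/
noncomputable def steinResidual (u : ℝ → ℝ) (x : ℝ) : ℝ :=
  deriv u x + x * u x

@[fun_prop]
theorem measurable_steinResidual {u : ℝ → ℝ} (hu : Measurable u) : Measurable (steinResidual u) :=
  (measurable_deriv u).add (measurable_id.mul hu)

theorem steinResidual_sub_stdNormalDensity {p : ℝ → ℝ} {x : ℝ} (hp : DifferentiableAt ℝ p x) :
    steinResidual (fun x => p x - φ x) x = steinResidual p x := by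
  rw [steinResidual, (hp.hasDerivAt.fun_sub (hasDerivAt_stdNormalDensity x)).deriv, steinResidual]
  ring

namespace IsAbsCont

variable {u : ℝ → ℝ}

theorem integral_steinResidual_div (hu : IsAbsCont u) (a b : ℝ) :
    ∫ t in a..b, steinResidual u t / φ t = u b / φ b - u a / φ a := by
  have hinv : IsAbsCont fun t => (φ t)⁻¹ :=
    of_contDiff (contDiff_stdNormalDensity.fun_inv fun t => (stdNormalDensity_pos t).ne')
  have hderiv (t : ℝ) : deriv (fun t => (φ t)⁻¹) t = t / φ t := by
    rw [((hasDerivAt_stdNormalDensity t).fun_inv (stdNormalDensity_pos t).ne').deriv]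
    field [(stdNormalDensity_pos t).ne']
  simp only [div_eq_mul_inv, ← (hu a b).integral_deriv_mul_eq_sub (hinv a b), hderiv]
  refine intervalIntegral.integral_congr fun t _ => ?_
  simp only [steinResidual]
  ring

theorem enorm_sub_mul_stdNormalDensity_le (hu : IsAbsCont u) (x : ℝ) :
    ‖u x - u 0 / φ 0 * φ x‖ₑ ≤ ‖φ x‖ₑ * ∫⁻ t in uIoc 0 x, ‖steinResidual u t / φ t‖ₑ := by
  have hrepr : u x - u 0 / φ 0 * φ x = φ x * ∫ t in (0 : ℝ)..x, steinResidual u t / φ t := by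
    rw [hu.integral_steinResidual_div]
    field [(stdNormalDensity_pos x).ne']
  rw [hrepr, enorm_mul, ← ofReal_norm (∫ t in (0 : ℝ)..x, _),
    intervalIntegral.norm_intervalIntegral_eq, ofReal_norm]
  gcongr
  exact enorm_integral_le_lintegral_enorm _

theorem lintegral_mul_enorm_sub_le (hu : IsAbsCont u) {w : ℝ → ℝ≥0∞} (hw : Measurable w)
    (heven : ∀ x, w (-x) = w x) {C : ℝ≥0∞}
    (hC : ∀ s : ℝ, 0 ≤ s → ∫⁻ x in Ioi s, w x * ‖φ x‖ₑ ≤ C * ‖φ s‖ₑ) :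
    ∫⁻ x, w x * ‖u x - u 0 / φ 0 * φ x‖ₑ ≤ C * ∫⁻ t, ‖steinResidual u t‖ₑ := by
  have hm : Measurable u := hu.continuous.measurable
  have habs (t : ℝ) : φ |t| = φ t := by
    rcases abs_choice t with h | h <;> simp only [h, stdNormalDensity_neg]
  calc ∫⁻ x, w x * ‖u x - u 0 / φ 0 * φ x‖ₑ
      ≤ ∫⁻ x, ∫⁻ t in uIoc 0 x, w x * ‖φ x‖ₑ * ‖steinResidual u t / φ t‖ₑ := by
        refine lintegral_mono fun x => ?_
        rw [lintegral_const_mul _ (by fun_prop), mul_assoc]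
        gcongr
        exact hu.enorm_sub_mul_stdNormalDensity_le x
    _ = ∫⁻ t, ∫⁻ x in Ioi |t|, w x * ‖φ x‖ₑ * ‖steinResidual u t / φ t‖ₑ :=
        lintegral_lintegral_uIoc_zero_of_even (by fun_prop) fun x t => by
          rw [heven, stdNormalDensity_neg]
    _ ≤ ∫⁻ t, C * ‖steinResidual u t‖ₑ := by
        refine lintegral_mono fun t => ?_
        rw [lintegral_mul_const _ (by fun_prop)]
        calc (∫⁻ x in Ioi |t|, w x * ‖φ x‖ₑ) * ‖steinResidual u t / φ t‖ₑ
            ≤ C * ‖φ t‖ₑ * ‖steinResidual u t / φ t‖ₑ := by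
              gcongr
              exact (hC |t| (abs_nonneg t)).trans_eq (by rw [habs])
          _ = C * ‖steinResidual u t‖ₑ := by
              rw [mul_assoc, ← enorm_mul, mul_div_cancel₀ _ (stdNormalDensity_pos t).ne']
    _ = C * ∫⁻ t, ‖steinResidual u t‖ₑ := lintegral_const_mul _ (by fun_prop)

theorem enorm_apply_zero_le (hu : IsAbsCont u) (hi : Integrable u) (h0 : ∫ x, u x = 0) :
    ‖u 0‖ₑ ≤ ∫⁻ t, ‖steinResidual u t‖ₑ := by
  have hφ0 := (stdNormalDensity_pos 0).ne'
  have hint : ∫ x, (u x - u 0 / φ 0 * φ x) = -(u 0 / φ 0) := by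
    rw [integral_sub hi (integrable_stdNormalDensity.const_mul _), h0, integral_const_mul,
      integral_stdNormalDensity]
    ring
  have hratio : ‖u 0 / φ 0‖ₑ ≤ ‖(φ 0)⁻¹‖ₑ * ∫⁻ t, ‖steinResidual u t‖ₑ :=
    calc ‖u 0 / φ 0‖ₑ = ‖∫ x, (u x - u 0 / φ 0 * φ x)‖ₑ := by rw [hint, enorm_neg]
      _ ≤ ∫⁻ x, ‖u x - u 0 / φ 0 * φ x‖ₑ := enorm_integral_le_lintegral_enorm _
      _ ≤ ‖(φ 0)⁻¹‖ₑ * ∫⁻ t, ‖steinResidual u t‖ₑ := by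
          simpa only [one_mul] using hu.lintegral_mul_enorm_sub_le (w := fun _ => 1)
            measurable_const (fun _ => rfl) fun s hs => by
              simpa only [one_mul] using lintegral_Ioi_enorm_stdNormalDensity_le hs
  calc ‖u 0‖ₑ = ‖φ 0‖ₑ * ‖u 0 / φ 0‖ₑ := by rw [← enorm_mul, mul_div_cancel₀ _ hφ0]
    _ ≤ ‖φ 0‖ₑ * (‖(φ 0)⁻¹‖ₑ * ∫⁻ t, ‖steinResidual u t‖ₑ) := by gcongr
    _ = ∫⁻ t, ‖steinResidual u t‖ₑ := by
        rw [← mul_assoc, ← enorm_mul, mul_inv_cancel₀ hφ0, enorm_one, one_mul]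

theorem lintegral_enorm_id_mul_le (hu : IsAbsCont u) :
    ∫⁻ x, ‖x * u x‖ₑ ≤ 2 * ‖u 0‖ₑ + ∫⁻ t, ‖steinResidual u t‖ₑ := by
  calc ∫⁻ x, ‖x * u x‖ₑ
      ≤ ∫⁻ x, (‖u 0 / φ 0‖ₑ * (‖x‖ₑ * ‖φ x‖ₑ) + ‖x‖ₑ * ‖u x - u 0 / φ 0 * φ x‖ₑ) := by
        refine lintegral_mono fun x => ?_
        have hsplit : x * u x = u 0 / φ 0 * (x * φ x) + x * (u x - u 0 / φ 0 * φ x) := by ring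
        simpa only [hsplit, enorm_mul] using
          enorm_add_le (u 0 / φ 0 * (x * φ x)) (x * (u x - u 0 / φ 0 * φ x))
    _ = ‖u 0 / φ 0‖ₑ * (2 * ‖φ 0‖ₑ) + ∫⁻ x, ‖x‖ₑ * ‖u x - u 0 / φ 0 * φ x‖ₑ := by
        rw [lintegral_add_left (by fun_prop), lintegral_const_mul _ (by fun_prop),
          lintegral_enorm_mul_stdNormalDensity]
    _ = 2 * ‖u 0‖ₑ + ∫⁻ x, ‖x‖ₑ * ‖u x - u 0 / φ 0 * φ x‖ₑ := by
        rw [mul_left_comm, ← enorm_mul, div_mul_cancel₀ _ (stdNormalDensity_pos 0).ne']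
    _ ≤ 2 * ‖u 0‖ₑ + ∫⁻ t, ‖steinResidual u t‖ₑ := by
        refine add_le_add le_rfl ?_
        simpa only [one_mul] using hu.lintegral_mul_enorm_sub_le measurable_enorm enorm_neg
          (C := 1) fun s hs => by rw [lintegral_Ioi_enorm_mul_stdNormalDensity hs, one_mul]

theorem tvNorm_le_four_mul_lintegral_steinResidual (hu : IsAbsCont u) (hi : Integrable u)
    (h0 : ∫ x, u x = 0) : tvNorm u ≤ 4 * ∫⁻ t, ‖steinResidual u t‖ₑ := by
  have hm : Measurable u := hu.continuous.measurable
  calc tvNorm u ≤ ∫⁻ x, ‖deriv u x‖ₑ := hu.tvNorm_le_lintegral_enorm_deriv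
    _ ≤ ∫⁻ x, (‖steinResidual u x‖ₑ + ‖x * u x‖ₑ) := lintegral_mono fun x => by
        simpa only [steinResidual, add_sub_cancel_right] using
          enorm_sub_le (a := steinResidual u x) (b := x * u x)
    _ = (∫⁻ t, ‖steinResidual u t‖ₑ) + ∫⁻ x, ‖x * u x‖ₑ := lintegral_add_right _ (by fun_prop)
    _ ≤ (∫⁻ t, ‖steinResidual u t‖ₑ) +
          (2 * (∫⁻ t, ‖steinResidual u t‖ₑ) + ∫⁻ t, ‖steinResidual u t‖ₑ) := by
        gcongr
        refine hu.lintegral_enorm_id_mul_le.trans ?_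
        gcongr
        exact hu.enorm_apply_zero_le hi h0
    _ = 4 * ∫⁻ t, ‖steinResidual u t‖ₑ := by ring

end IsAbsCont

section CauchySchwarz

variable {α : Type*} [MeasurableSpace α] {μ : Measure α} {f g h : α → ℝ}

theorem abs_eq_sqrt_mul_sqrt_of_sq_eq_mul {a b c : ℝ} (hb : 0 ≤ b) (h : a ^ 2 = b * c) :
    |a| = √b * √c := by
  rw [← Real.sqrt_mul hb, ← h, Real.sqrt_sq_eq_abs]

theorem memLp_two_sqrt (hg0 : ∀ x, 0 ≤ g x) (hg : Integrable g μ) :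
    MemLp (fun x => √(g x)) 2 μ :=
  (memLp_two_iff_integrable_sq
    (Real.continuous_sqrt.comp_aestronglyMeasurable hg.aestronglyMeasurable)).2 <| by
      simpa only [Real.sq_sqrt (hg0 _)] using hg

theorem integrable_of_sq_eq_mul (hf : AEStronglyMeasurable f μ) (hg0 : ∀ x, 0 ≤ g x)
    (hh0 : ∀ x, 0 ≤ h x) (hg : Integrable g μ) (hh : Integrable h μ)
    (hfgh : ∀ x, f x ^ 2 = g x * h x) : Integrable f μ :=
  ((memLp_two_sqrt hg0 hg).integrable_mul (memLp_two_sqrt hh0 hh)).mono' hf <|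
    ae_of_all _ fun x => (abs_eq_sqrt_mul_sqrt_of_sq_eq_mul (hg0 x) (hfgh x)).le

theorem sq_integral_abs_le_of_sq_eq_mul (hg0 : ∀ x, 0 ≤ g x) (hh0 : ∀ x, 0 ≤ h x)
    (hg : Integrable g μ) (hh : Integrable h μ) (hfgh : ∀ x, f x ^ 2 = g x * h x) :
    (∫ x, |f x| ∂μ) ^ 2 ≤ (∫ x, g x ∂μ) * ∫ x, h x ∂μ := by
  have hholder : ∫ x, √(g x) * √(h x) ∂μ ≤ √(∫ x, g x ∂μ) * √(∫ x, h x ∂μ) := by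
    simpa [Real.sqrt_eq_rpow (∫ x, g x ∂μ), Real.sqrt_eq_rpow (∫ x, h x ∂μ), hg0, hh0] using
      integral_mul_le_Lp_mul_Lq_of_nonneg (μ := μ) Real.HolderConjugate.two_two
        (ae_of_all _ fun x => Real.sqrt_nonneg (g x)) (ae_of_all _ fun x => Real.sqrt_nonneg (h x))
        (by simpa using memLp_two_sqrt hg0 hg) (by simpa using memLp_two_sqrt hh0 hh)
  calc (∫ x, |f x| ∂μ) ^ 2 = (∫ x, √(g x) * √(h x) ∂μ) ^ 2 := by
        simp only [abs_eq_sqrt_mul_sqrt_of_sq_eq_mul (hg0 _) (hfgh _)]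
    _ ≤ (√(∫ x, g x ∂μ) * √(∫ x, h x ∂μ)) ^ 2 := by gcongr
    _ = (∫ x, g x ∂μ) * ∫ x, h x ∂μ := by
        rw [mul_pow, Real.sq_sqrt (integral_nonneg hg0), Real.sq_sqrt (integral_nonneg hh0)]

end CauchySchwarz

section FisherInfo

variable {p : ℝ → ℝ}

theorem IsAbsCont.of_fisherInfo_lt_top (hI : fisherInfo p < ∞) : IsAbsCont p := by
  by_contra h
  simp [fisherInfo, h] at hI

theorem deriv_eq_zero_of_nonneg_of_eq_zero (h0 : ∀ x, 0 ≤ p x) {x : ℝ} (hx : p x = 0) :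
    deriv p x = 0 :=
  IsLocalMin.deriv_eq_zero (Eventually.of_forall fun y => hx ▸ h0 y)

theorem deriv_sq_div_mul_self (h0 : ∀ x, 0 ≤ p x) (x : ℝ) :
    deriv p x ^ 2 / p x * p x = deriv p x ^ 2 :=
  div_mul_cancel_of_imp fun hx => by simp [deriv_eq_zero_of_nonneg_of_eq_zero h0 hx]

theorem steinResidual_sq_div_mul_self (h0 : ∀ x, 0 ≤ p x) (x : ℝ) :
    steinResidual p x ^ 2 / p x * p x = steinResidual p x ^ 2 :=
  div_mul_cancel_of_imp fun hx => by
    simp [steinResidual, hx, deriv_eq_zero_of_nonneg_of_eq_zero h0 hx]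

theorem steinResidual_sq_div (h0 : ∀ x, 0 ≤ p x) (x : ℝ) :
    steinResidual p x ^ 2 / p x =
      deriv p x ^ 2 / p x + 2 * (x * deriv p x) + x ^ 2 * p x := by
  rcases eq_or_ne (p x) 0 with hx | hx
  · simp [hx, deriv_eq_zero_of_nonneg_of_eq_zero h0 hx]
  · rw [steinResidual]
    field

theorem measurable_deriv_sq_div (hp : Measurable p) : Measurable fun x => deriv p x ^ 2 / p x :=
  ((measurable_deriv p).pow_const 2).div hp

theorem fisherInfo_eq_lintegral (hp : IsAbsCont p) (h0 : ∀ x, 0 ≤ p x) :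
    fisherInfo p = ∫⁻ x, ENNReal.ofReal (deriv p x ^ 2 / p x) := by
  rw [fisherInfo, if_pos hp]
  refine setLIntegral_eq_of_support_subset fun x hx => (h0 x).lt_of_ne' fun h => hx ?_
  simp [h]

theorem toReal_fisherInfo (hp : IsAbsCont p) (h0 : ∀ x, 0 ≤ p x) :
    (fisherInfo p).toReal = ∫ x, deriv p x ^ 2 / p x := by
  rw [fisherInfo_eq_lintegral hp h0, integral_eq_lintegral_of_nonneg_ae
    (ae_of_all _ fun x => div_nonneg (sq_nonneg _) (h0 x))
    (measurable_deriv_sq_div hp.continuous.measurable).aestronglyMeasurable]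

theorem toReal_fisherInfo_stdNormalDensity : (fisherInfo φ).toReal = 1 := by
  have hint (x : ℝ) : deriv φ x ^ 2 / φ x = φ x • x ^ 2 := by
    rw [(hasDerivAt_stdNormalDensity x).deriv, smul_eq_mul]
    field [(stdNormalDensity_pos x).ne']
  calc (fisherInfo φ).toReal = ∫ x, φ x • x ^ 2 := by
        simp only [toReal_fisherInfo (.of_contDiff contDiff_stdNormalDensity)
          fun x => (stdNormalDensity_pos x).le, hint]
    _ = ∫ x, id x ^ 2 ∂gaussianReal 0 1 :=
        (integral_gaussianReal_eq_integral_smul one_ne_zero).symm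
    _ = Var[id; gaussianReal 0 1] := (variance_of_integral_eq_zero aemeasurable_id (by simp)).symm
    _ = 1 := by simp

theorem integrable_deriv_sq_div (h0 : ∀ x, 0 ≤ p x) (hI : fisherInfo p < ∞) :
    Integrable fun x => deriv p x ^ 2 / p x := by
  have hac := IsAbsCont.of_fisherInfo_lt_top hI
  rw [fisherInfo_eq_lintegral hac h0] at hI
  exact ⟨(measurable_deriv_sq_div hac.continuous.measurable).aestronglyMeasurable,
    (hasFiniteIntegral_iff_ofReal (ae_of_all _ fun x => div_nonneg (sq_nonneg _) (h0 x))).2 hI⟩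

theorem integrable_deriv_of_fisherInfo_lt_top (h0 : ∀ x, 0 ≤ p x) (hI : fisherInfo p < ∞)
    (hp : Integrable p) : Integrable (deriv p) :=
  integrable_of_sq_eq_mul (by fun_prop) (fun x => div_nonneg (sq_nonneg _) (h0 x)) h0
    (integrable_deriv_sq_div h0 hI) hp fun x => (deriv_sq_div_mul_self h0 x).symm

theorem integrable_id_mul_deriv_of_fisherInfo_lt_top (h0 : ∀ x, 0 ≤ p x) (hI : fisherInfo p < ∞)
    (hp2 : Integrable fun x => x ^ 2 * p x) : Integrable fun x => x * deriv p x :=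
  integrable_of_sq_eq_mul (by fun_prop) (fun x => div_nonneg (sq_nonneg _) (h0 x))
    (fun x => mul_nonneg (sq_nonneg x) (h0 x)) (integrable_deriv_sq_div h0 hI) hp2 fun x => by
      linear_combination -x ^ 2 * deriv_sq_div_mul_self h0 x

theorem integrable_id_mul_of_integrable_sq_mul (h0 : ∀ x, 0 ≤ p x) (hp : Integrable p)
    (hp2 : Integrable fun x => x ^ 2 * p x) : Integrable fun x => x * p x :=
  integrable_of_sq_eq_mul (aestronglyMeasurable_id.mul hp.aestronglyMeasurable) h0
    (fun x => mul_nonneg (sq_nonneg x) (h0 x)) hp hp2 fun x => by ring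

theorem integrable_steinResidual (h0 : ∀ x, 0 ≤ p x) (hI : fisherInfo p < ∞) (hp : Integrable p)
    (hp2 : Integrable fun x => x ^ 2 * p x) : Integrable (steinResidual p) :=
  (integrable_deriv_of_fisherInfo_lt_top h0 hI hp).add
    (integrable_id_mul_of_integrable_sq_mul h0 hp hp2)

theorem integrable_steinResidual_sq_div (h0 : ∀ x, 0 ≤ p x) (hI : fisherInfo p < ∞)
    (hp2 : Integrable fun x => x ^ 2 * p x) :
    Integrable fun x => steinResidual p x ^ 2 / p x := by
  simp only [steinResidual_sq_div h0]
  exact ((integrable_deriv_sq_div h0 hI).add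
    ((integrable_id_mul_deriv_of_fisherInfo_lt_top h0 hI hp2).const_mul 2)).add hp2

theorem integral_steinResidual_sq_div (h0 : ∀ x, 0 ≤ p x) (hI : fisherInfo p < ∞)
    (hp : Integrable p) (hp2 : Integrable fun x => x ^ 2 * p x) :
    ∫ x, steinResidual p x ^ 2 / p x =
      (fisherInfo p).toReal - 2 * (∫ x, p x) + ∫ x, x ^ 2 * p x := by
  have hac := IsAbsCont.of_fisherInfo_lt_top hI
  have hJ := integrable_deriv_sq_div h0 hI
  have hxd := integrable_id_mul_deriv_of_fisherInfo_lt_top h0 hI hp2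
  have hJxd : Integrable fun x => deriv p x ^ 2 / p x + 2 * (x * deriv p x) :=
    hJ.add (hxd.const_mul 2)
  simp only [steinResidual_sq_div h0]
  rw [integral_add hJxd hp2, integral_add hJ (hxd.const_mul 2),
    integral_const_mul, toReal_fisherInfo hac h0,
    hac.integral_id_mul_deriv hp (integrable_id_mul_of_integrable_sq_mul h0 hp hp2) hxd]
  ring

theorem sq_integral_abs_steinResidual_le (h0 : ∀ x, 0 ≤ p x) (hI : fisherInfo p < ∞)
    (hp : Integrable p) (hp2 : Integrable fun x => x ^ 2 * p x) :
    (∫ x, |steinResidual p x|) ^ 2 ≤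
      ((fisherInfo p).toReal - 2 * (∫ x, p x) + ∫ x, x ^ 2 * p x) * ∫ x, p x := by
  rw [← integral_steinResidual_sq_div h0 hI hp hp2]
  exact sq_integral_abs_le_of_sq_eq_mul (fun x => div_nonneg (sq_nonneg _) (h0 x)) h0
    (integrable_steinResidual_sq_div h0 hI hp2) hp fun x =>
      (steinResidual_sq_div_mul_self h0 x).symm

end FisherInfo

namespace HasRealDensity

variable {Ω : Type*} [MeasurableSpace Ω] {P : Measure Ω} {X : Ω → ℝ} {p f : ℝ → ℝ}

theorem integrable_mul_iff (hp : HasRealDensity P X p) (hm : Measurable p) (hf : Measurable f) :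
    Integrable (fun x => f x * p x) ↔ Integrable (fun ω => f (X ω)) P := by
  rw [← Function.comp_def f X, ← integrable_map_measure hf.aestronglyMeasurable hp.1.aemeasurable,
    hp.2.2, integrable_withDensity_iff hm.ennreal_ofReal (by simp)]
  simp only [ENNReal.toReal_ofReal (hp.2.1 _)]

theorem integral_mul (hp : HasRealDensity P X p) (hm : Measurable p) (hf : Measurable f) :
    ∫ x, f x * p x = ∫ ω, f (X ω) ∂P := by
  rw [← integral_map hp.1.aemeasurable hf.aestronglyMeasurable, hp.2.2,
    integral_withDensity_eq_integral_toReal_smul hm.ennreal_ofReal (by simp)]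
  simp only [ENNReal.toReal_ofReal (hp.2.1 _), smul_eq_mul, mul_comm]

theorem integrable [IsFiniteMeasure P] (hp : HasRealDensity P X p) (hm : Measurable p) :
    Integrable p := by
  simpa using (hp.integrable_mul_iff hm (f := fun _ => 1) measurable_const).2 (by simp)

theorem integrable_sq_mul (hp : HasRealDensity P X p) (hm : Measurable p) (hX : MemLp X 2 P) :
    Integrable fun x => x ^ 2 * p x :=
  (hp.integrable_mul_iff hm (measurable_id.pow_const 2)).2 hX.integrable_sq

theorem integral_eq_one [IsProbabilityMeasure P] (hp : HasRealDensity P X p)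
    (hm : Measurable p) : ∫ x, p x = 1 := by
  simpa using hp.integral_mul hm (f := fun _ => 1) measurable_const

theorem integral_abs_steinResidual_le [IsProbabilityMeasure P] (hp : HasRealDensity P X p)
    (hX : MemLp X 2 P) (hI : fisherInfo p < ∞) :
    ∫ x, |steinResidual p x| ≤ √(relFisherInfo p + ((∫ ω, X ω ^ 2 ∂P) - 1)) := by
  have hm := (IsAbsCont.of_fisherInfo_lt_top hI).continuous.measurable
  refine Real.le_sqrt_of_sq_le <| (sq_integral_abs_steinResidual_le hp.2.1 hI (hp.integrable hm)
    (hp.integrable_sq_mul hm hX)).trans_eq ?_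
  rw [hp.integral_eq_one hm, hp.integral_mul hm (f := fun x => x ^ 2) (by fun_prop),
    relFisherInfo, toReal_fisherInfo_stdNormalDensity]
  ring

end HasRealDensity

theorem proposition2p4_general {Ω : Type*} [MeasurableSpace Ω] (P : Measure Ω)
    [IsProbabilityMeasure P] (X : Ω → ℝ) (p : ℝ → ℝ) (hp : HasRealDensity P X p)
    (hX : MemLp X 2 P) (hI : fisherInfo p < ∞) :
    tvNorm (fun x => p x - stdNormalDensity x) ≤
      ENNReal.ofReal (4 * √(relFisherInfo p + ((∫ ω, X ω ^ 2 ∂P) - 1))) := by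
  have hac := IsAbsCont.of_fisherInfo_lt_top hI
  have hm := hac.continuous.measurable
  have hpi := hp.integrable hm
  have hr := integrable_steinResidual hp.2.1 hI hpi (hp.integrable_sq_mul hm hX)
  have hu : IsAbsCont fun x => p x - φ x := hac.sub (.of_contDiff contDiff_stdNormalDensity)
  have hzero : ∫ x, (p x - φ x) = 0 := by
    rw [integral_sub hpi integrable_stdNormalDensity, hp.integral_eq_one hm,
      integral_stdNormalDensity, sub_self]
  calc tvNorm (fun x => p x - φ x)
      ≤ 4 * ∫⁻ x, ‖steinResidual (fun x => p x - φ x) x‖ₑ :=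
        hu.tvNorm_le_four_mul_lintegral_steinResidual (hpi.sub integrable_stdNormalDensity) hzero
    _ = 4 * ∫⁻ x, ‖steinResidual p x‖ₑ := by
        rw [lintegral_congr_ae (hac.ae_differentiableAt.mono fun x hx => by
          rw [steinResidual_sub_stdNormalDensity hx])]
    _ = ENNReal.ofReal (4 * ∫ x, |steinResidual p x|) := by
        rw [ENNReal.ofReal_mul zero_le_four, ENNReal.ofReal_ofNat,
          ← ofReal_integral_norm_eq_lintegral_enorm hr]
        simp only [Real.norm_eq_abs]
    _ ≤ ENNReal.ofReal (4 * √(relFisherInfo p + ((∫ ω, X ω ^ 2 ∂P) - 1))) := by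
        gcongr
        exact hp.integral_abs_steinResidual_le hX hI

theorem proposition2p4 {Ω : Type*} [MeasurableSpace Ω] (P : Measure Ω) [IsProbabilityMeasure P]
    (X : Ω → ℝ) (p : ℝ → ℝ) (hp : HasRealDensity P X p)
    (hmean : P[X] = 0) (hvar : Var[X; P] = 1) (hI : fisherInfo p < ∞) :
    tvNorm (fun x => p x - stdNormalDensity x) ≤ ENNReal.ofReal (4 * √(relFisherInfo p)) := by
  simpa [← variance_of_integral_eq_zero hp.1.aemeasurable hmean, hvar] using
    proposition2p4_general P X p hp
      (memLp_two_of_variance_ne_zero hp.1.aestronglyMeasurable (by simp [hvar])) hI
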